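/- **Setting.** Let $G_0$ be an undirected unweighted graph on $n$ vertices $V$, and let $G_t$ be the graph after the first $t$ edge deletions of an arbitrary sequence of deletions; $\mathrm{dist}$ is the hop distance in the current graph ($\infty$ between different components), $B(v,r)$ the closed ball. Let $0<\epsilon\le 1/3$, $\zeta=n^{\sqrt{6/\epsilon}/\sqrt{\log_2 n}}$, $\beta=(2/\epsilon)\zeta$, $L=\lceil\log_2 n\rceil$. A vertex is heavy if its degree exceeds $\sqrt n$. Let $Q\subseteq V$ and $S_1,\dots,S_L\subseteq V$. For every $t$ let $H_t$ be a $(1+\epsilon/2,\zeta)$-emulator of $G_t$, i.e. a weighted graph on $V$ with $\mathrm{dist}(x,y)\le \mathrm{dist}(x,y,H_t)\le(1+\epsilon/2)\,\mathrm{dist}(x,y)+\zeta$ for all $x,y$. Put $\mathrm{dist}_q(x,y)=\mathrm{dist}(x,q)+\mathrm{dist}(q,y)$, $\mathrm{dist}_Q=\min_{q\in Q}\mathrm{dist}_q$; $\mathrm{dist}^{BR}(q,x)=\mathrm{dist}(q,x)$ if this is at most $\beta$ and $\mathrm{dist}(q,x,H_t)$ otherwise; $\mathrm{dist}^{BR}_q(x,y)=\mathrm{dist}^{BR}(q,x)+\mathrm{dist}^{BR}(q,y)$.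 A minimum over an empty set is $\infty$. **Data structure.** - $\mathrm{Heap}^{(1)}_{(x,y)}$ holds the current values $\mathrm{dist}_q(x,y)<8\beta/\epsilon$, $q\in Q$. - $\mathrm{Heap}^{(1+\epsilon)}_{(x,y)}[q]=d_{last}(x,q)+d_{last}(y,q)$ for $q\in Q$, where $d_{last}(x,q)$ is initially $\mathrm{dist}^{BR}(q,x)$ and is reset to $\mathrm{dist}^{BR}(q,x)$ whenever this value increases and is then at least $(1+\epsilon)d_{last}(x,q)$. - For $1\le i\le L$ and $y\in S_i$, $\mathrm{Heap}^{(*,1+\epsilon)}_{(x,y)}$ initially holds the values $\mathrm{dist}^{BR}_q(x,y)\le(1+\epsilon)2^i$, $q\in Q$; entry $q$ is reset to the current $\mathrm{dist}_q^{BR}(x,y)$ whenever $\mathrm{dist}^{BR}(q,x)$ or $\mathrm{dist}^{BR}(q,y)$ increases, and is removed permanently when $\mathrm{dist}^{BR}_q(x,y)$ exceeds $(1+\epsilon)2^i$. - For a tree $T$ rooted at $s\in S_i$ let $d(v)=d(v,s,B(T,1))$ be the minimum of $\mathrm{dist}(s,x,T)+1$ over neighbours $x\in T$ of $v$. The vertex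 $v$ *is not light for $(s,T)$* if (1) $d(v)\le 8\beta/\epsilon$ and $d(v)\ge \mathrm{dist}_Q(v,s)-2$; or (2) $d(v)>8\beta/\epsilon$, $\mathrm{dist}(v,Q)\ge\beta$ and $d(v)\ge\mathrm{dist}(v,w)+\min(\mathrm{Heap}^{(*,1+\epsilon)}_{(w,s)})/(1+\epsilon)$ for some $w\in B(v,\beta)\setminus T$; or (3) $d(v)>8\beta/\epsilon$ and $d(v)\ge\min(\mathrm{Heap}^{(*,1+\epsilon)}_{(v,s)})/(1+\epsilon)$. - For $1\le i\le L$ and $s\in S_i$ a tree $T(s)$ rooted at $s$, of depth at most $2^i$, is built at the start and updated after every deletion, in order of increasing depth $k=1,\dots,2^i$: a vertex $v$ whose best connection to the vertices placed so far has length $d(v)=k$ keeps its place in the tree, at depth $k$, if it was in the tree before the deletion with depth at least $k$; otherwise it is put into the tree at depth $k$ by a best edge, unless it is not light for $(s,T)$, where $T$ consists of the vertices placed so far and of the vertices other than $v$ of the previous tree that had depth at least $k$. - The pivot $p_i(v)$ is a vertex $p\in S_i$ with $v\in T(p)$ that minimizes $\mathrm{dist}(v,p,T(p))$. Ties, for pivots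 and tree edges, are broken by an arbitrary fixed rule. **Query.** For a pair $(s,t)$ let $i$ be the least index such that $p_i(s)$ exists and $t\in T(p_i(s))$. The query returns $$\hat d(s,t)=\min\{\mathrm{dist}(s,p_i(s),T(p_i(s)))+\mathrm{dist}(t,p_i(s),T(p_i(s))),\ \min(\mathrm{Heap}^{(1)}_{(s,t)}),\ (1+\epsilon)\min(\mathrm{Heap}^{(1+\epsilon)}_{(s,t)})\},$$ where the first term is $\infty$ if there is no such $i$. **Good event $\mathcal E$.** For every version $G_t$ of the graph: every heavy vertex has a neighbour in $Q$; for every vertex $v$ and $1\le i\le L$ such that some vertex $z$ has $\epsilon 2^i\le\mathrm{dist}(v,z)<\infty$, the set $S_i$ meets $B(v,\epsilon2^i)$; and $Q$ meets every ball $B(v,\beta)$ with at least $\sqrt n$ vertices. **Lemma.** There is an absolute constant $C$ such that the following holds for all such $n$, $\epsilon$, $G_0$ and deletion sequences. (a) If $Q,S_1,\dots,S_L$ satisfy $\mathcal E$, then for all emulators $H_t$ and all tie-breaking rules, after any number of deletions, all $s,t\in V$ satisfy $\mathrm{dist}(s,t)\le\hat d(s,t)$, and if $s\neq t$ then also $\hat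 d(s,t)\le(1+\epsilon)^C(\mathrm{dist}(s,t)+2)$. (b) If $c>0$, every vertex is put into $Q$ with probability $\min\{c\ln n/\sqrt n,1\}$ and into $S_i$ with probability $\min\{c\ln n/(\epsilon2^i),1\}$, all independently, then $\mathcal E$ holds with probability at least $1-3/n^{c-3}$. -/

import Mathlib

open scoped ENNReal NNReal

namespace DecOracle

/-! ## Distances, weighted graphs, emulators -/

/-- The hop distance of a graph, `∞` between vertices that are not connected. -/
noncomputable def gdist {V : Type*} (G : SimpleGraph V) (x y : V) : ℝ≥0∞ :=
  ((G.edist x y : ℕ∞) : ℝ≥0∞)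

/-- An undirected graph with nonnegative edge weights. -/
structure WeightedGraph (V : Type*) where
  graph : SimpleGraph V
  weight : Sym2 V → ℝ≥0

/-- The shortest path distance of a weighted graph. -/
noncomputable def WeightedGraph.dist {V : Type*} (H : WeightedGraph V) (x y : V) : ℝ≥0∞ :=
  ⨅ p : H.graph.Walk x y, (p.edges.map fun e => (H.weight e : ℝ≥0∞)).sum

/-- `H` is an `(a, b)`-emulator of `G`. -/
def IsEmulator {V : Type*} (G : SimpleGraph V) (H : WeightedGraph V) (a b : ℝ) : Prop :=
  ∀ x y, gdist G x y ≤ H.dist x y ∧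
    H.dist x y ≤ ENNReal.ofReal a * gdist G x y + ENNReal.ofReal b

/-- The additive error `ζ = n ^ (√(6/ε) / √(log n))` of the emulator. -/
noncomputable def zeta (n : ℕ) (ε : ℝ) : ℝ :=
  (n : ℝ) ^ (Real.sqrt (6 / ε) / Real.sqrt (Real.logb 2 n))

/-- `β = (2/ε) ζ`. -/
noncomputable def beta (n : ℕ) (ε : ℝ) : ℝ := 2 / ε * zeta n ε

/-- The number `⌈log₂ n⌉` of distance scales; scales are `i = 1, …, numLevels n`. -/
def numLevels (n : ℕ) : ℕ := Nat.clog 2 n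

/-- The version of the graph after the first `t` deletions. -/
def graphAt {V : Type*} (G₀ : SimpleGraph V) (del : ℕ → Sym2 V) (t : ℕ) : SimpleGraph V :=
  G₀.deleteEdges {e | ∃ k < t, del k = e}

/-! ## The random samples -/

/-- Closed ball of real radius `r`. -/
def ball {V : Type*} (G : SimpleGraph V) (v : V) (r : ℝ) : Set V :=
  {w | gdist G v w ≤ ENNReal.ofReal r}

/-- The good event for one version `G` of the graph: `Q` hits the neighbourhood of every heavy
vertex, `S i` hits the ball of radius `ε 2^i` around every vertex which has a vertex at (finite)
distance at least `ε 2^i`, and `Q` hits every `β`-ball with at least `√n` vertices. -/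
def HitsAll {V : Type*} [Fintype V] (ε : ℝ) (G : SimpleGraph V) (Q : Set V) (S : ℕ → Set V) :
    Prop :=
  (∀ v, Real.sqrt (Fintype.card V) < ((G.neighborSet v).ncard : ℝ) →
    (G.neighborSet v ∩ Q).Nonempty) ∧
  (∀ v, ∀ i, 1 ≤ i → i ≤ numLevels (Fintype.card V) →
    (∃ z, ENNReal.ofReal (ε * 2 ^ i) ≤ gdist G v z ∧ gdist G v z ≠ ∞) →
    (S i ∩ ball G v (ε * 2 ^ i)).Nonempty) ∧
  (∀ v, Real.sqrt (Fintype.card V) ≤ ((ball G v (beta (Fintype.card V) ε)).ncard : ℝ) →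
    (Q ∩ ball G v (beta (Fintype.card V) ε)).Nonempty)

/-- The family `S₁, S₂, …` given by the list of its first `L` members. -/
def levelSets {V : Type*} {L : ℕ} (σ : Fin L → Set V) : ℕ → Set V :=
  fun i => {v | ∃ k : Fin L, (k : ℕ) + 1 = i ∧ v ∈ σ k}

/-- The random set that contains each vertex independently with probability `min p 1`
(and `max p 0`). -/
noncomputable def sampleSet (V : Type*) (p : ℝ) : MeasureTheory.Measure (Set V) :=
  ProbabilityTheory.setBernoulli Set.univ (Set.projIcc (0 : ℝ) 1 zero_le_one p)

/-- Independent samples `Q` (rate `c ln n / √n`) and `S i` (rate `min (c ln n / (ε 2^i)) 1`)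
for `1 ≤ i ≤ ⌈log₂ n⌉`. -/
noncomputable def sampling (V : Type*) [Fintype V] (ε c : ℝ) :
    MeasureTheory.Measure (Set V × (Fin (numLevels (Fintype.card V)) → Set V)) :=
  (sampleSet V (c * Real.log (Fintype.card V) / Real.sqrt (Fintype.card V))).prod
    (MeasureTheory.Measure.pi fun k : Fin (numLevels (Fintype.card V)) =>
      sampleSet V (c * Real.log (Fintype.card V) / (ε * 2 ^ ((k : ℕ) + 1))))

/-! ## The data structure -/

/-- Everything that determines a run of the algorithm: the initial graph, the sequence of deleted
edges, the parameter, the samples, the emulators `H t` maintained by the approximate single source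
subroutine, and the rule by which ties are broken. -/
structure Run (V : Type*) where
  G₀ : SimpleGraph V
  del : ℕ → Sym2 V
  ε : ℝ
  Q : Set V
  S : ℕ → Set V
  H : ℕ → WeightedGraph V
  pick : Set V → V

namespace Run

variable {V : Type*} [Fintype V] (R : Run V)

/-- The current graph after `t` deletions. -/
def G (t : ℕ) : SimpleGraph V := graphAt R.G₀ R.del t

/-- `β` for this run. -/
noncomputable def bet : ℝ := beta (Fintype.card V) R.ε

/-- The threshold `8β/ε`. -/
noncomputable def short : ℝ≥0∞ := ENNReal.ofReal (8 * R.bet / R.ε)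

/-- The factor `1 + ε`. -/
noncomputable def fac : ℝ≥0∞ := ENNReal.ofReal (1 + R.ε)

/-- `dist_q(x, y) = dist(x, q) + dist(q, y)`. -/
noncomputable def distVia (t : ℕ) (q x y : V) : ℝ≥0∞ := gdist (R.G t) x q + gdist (R.G t) q y

/-- `dist_Q(x, y)`. -/
noncomputable def distQ (t : ℕ) (x y : V) : ℝ≥0∞ := ⨅ q ∈ R.Q, R.distVia t q x y

/-- `dist(v, Q)`. -/
noncomputable def distToQ (t : ℕ) (v : V) : ℝ≥0∞ := ⨅ q ∈ R.Q, gdist (R.G t) v q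

open scoped Classical in
/-- The estimate `dist^BR(q, x)`: short distances (up to `β`) are handled separately, and exactly;
the other ones are the distances in the emulator. -/
noncomputable def distBR (t : ℕ) (q x : V) : ℝ≥0∞ :=
  if gdist (R.G t) q x ≤ ENNReal.ofReal R.bet then gdist (R.G t) q x else (R.H t).dist q x

/-- `dist_q^BR(x, y) = dist^BR(q, x) + dist^BR(q, y)`. -/
noncomputable def distBRVia (t : ℕ) (q x y : V) : ℝ≥0∞ := R.distBR t q x + R.distBR t q y

/-- Minimum of the exact heap of `(x, y)`, which holds the values `dist_q(x, y) < 8β/ε`. -/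
noncomputable def minHeap1 (t : ℕ) (x y : V) : ℝ≥0∞ :=
  ⨅ q ∈ R.Q, ⨅ _ : R.distVia t q x y < R.short, R.distVia t q x y

open scoped Classical in
/-- The copy `d_last(x, q)` of `dist^BR(q, x)`: it is refreshed when `dist^BR(q, x)` increases to
at least `(1+ε) d_last(x, q)`. -/
noncomputable def dLast : ℕ → V → V → ℝ≥0∞
  | 0, x, q => R.distBR 0 q x
  | t + 1, x, q =>
    if R.distBR t q x < R.distBR (t + 1) q x ∧ R.fac * dLast t x q ≤ R.distBR (t + 1) q x
    then R.distBR (t + 1) q x else dLast t x q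

/-- Entry with key `q` of the approximate heap of `(x, y)`: the value of `dist_q^BR(x, y)` formed
from the lazily refreshed copies. -/
noncomputable def heapApx (t : ℕ) (x y q : V) : ℝ≥0∞ := R.dLast t x q + R.dLast t y q

/-- Minimum of the approximate heap of `(x, y)`. -/
noncomputable def minHeapApx (t : ℕ) (x y : V) : ℝ≥0∞ := ⨅ q ∈ R.Q, R.heapApx t x y q

open scoped Classical in
/-- Entry with key `q` of the refined heap of `(x, y)` at scale `i` (`∞` = not in the heap).
Initially it is `dist_q^BR(x, y)`; it is refreshed when `dist^BR(q, x)` or `dist^BR(q, y)`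
increases, and `q` is removed for good when `dist_q^BR(x, y)` exceeds `(1+ε) 2^i`. -/
noncomputable def heapStar (i : ℕ) : ℕ → V → V → V → ℝ≥0∞
  | 0, x, y, q => if R.distBRVia 0 q x y ≤ R.fac * 2 ^ i then R.distBRVia 0 q x y else ∞
  | t + 1, x, y, q =>
    if heapStar i t x y q = ∞ ∨ R.fac * 2 ^ i < R.distBRVia (t + 1) q x y then ∞
    else if R.distBR t q x < R.distBR (t + 1) q x ∨ R.distBR t q y < R.distBR (t + 1) q y
      then R.distBRVia (t + 1) q x y
    else heapStar i t x y q

/-- Minimum of the refined heap of `(x, y)` at scale `i`. -/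
noncomputable def minHeapStar (i t : ℕ) (x y : V) : ℝ≥0∞ := ⨅ q ∈ R.Q, R.heapStar i t x y q

/-- "`v` is not light for `(s, T)`" at scale `i`, where `d` is the value `d(v, s, B(T,1))` and
`inT` is the vertex set of `T`. -/
def NotLight (i t : ℕ) (s v : V) (d : ℝ≥0∞) (inT : Set V) : Prop :=
  (d ≤ R.short ∧ R.distQ t v s ≤ d + 2) ∨
  (R.short < d ∧ ENNReal.ofReal R.bet ≤ R.distToQ t v ∧
    ∃ w ∈ ball (R.G t) v R.bet, w ∉ inT ∧
      gdist (R.G t) v w + R.minHeapStar i t w s / R.fac ≤ d) ∨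
  (R.short < d ∧ R.minHeapStar i t v s / R.fac ≤ d)

end Run

/-- A rooted tree that spans some of the vertices, as stored by the algorithm: depths
(`⊤` = not in the tree, `0` = the root) and parents. -/
structure PTree (V : Type*) where
  lev : V → ℕ∞
  par : V → V

/-- The vertices of the tree. -/
def PTree.verts {V : Type*} (T : PTree V) : Set V := {v | T.lev v ≠ ⊤}

/-- The tree as a graph: every vertex of the tree other than the root is joined to its parent. -/
def PTree.graph {V : Type*} (T : PTree V) : SimpleGraph V :=
  SimpleGraph.fromRel fun v x => T.lev v ≠ ⊤ ∧ T.lev v ≠ 0 ∧ x = T.par v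

/-- `dist(u, v, T)`. -/
noncomputable def PTree.dist {V : Type*} (T : PTree V) (u v : V) : ℝ≥0∞ := gdist T.graph u v

/-- The minimal value of (depth of `x`) + 1 over the neighbours `x` of `v`, where `lev` are the
depths in the tree built so far. -/
noncomputable def attach {V : Type*} (G : SimpleGraph V) (lev : V → ℕ∞) (v : V) : ℕ∞ :=
  ⨅ x, ⨅ _ : G.Adj v x, lev x + 1

namespace Run

variable {V : Type*} [Fintype V] (R : Run V)

open scoped Classical in
/-- Recovery of the tree rooted at `s` at scale `i` in version `t`, in order of increasing depth:
the depths after the vertices whose best connection to the tree has length at most `k` have been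
treated. `old` holds the depths before the last deletion (`⊤` everywhere at the start). Let `k` be
the length of the best connection of `v`. If `v` was in the tree and its depth does not increase,
it stays in the tree, without a test; otherwise it enters the tree, at depth `k`, unless it is not
light for the current tree, which consists of the vertices already placed and of the vertices of
the old tree at depth at least `k`, which are yet to be treated. -/
noncomputable def sweep (i t : ℕ) (s : V) (old : V → ℕ∞) : ℕ → V → ℕ∞
  | 0 => fun v => if v = s then 0 else ⊤
  | k + 1 => fun v =>
    let cur := sweep i t s old k
    let d : ℕ∞ := ((k + 1 : ℕ) : ℕ∞)
    if cur v ≠ ⊤ then cur v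
    else if attach (R.G t) cur v = d ∧
        ((old v ≠ ⊤ ∧ d ≤ old v) ∨
          ¬ R.NotLight i t s v (d : ℝ≥0∞)
            {w | w ≠ v ∧ (cur w ≠ ⊤ ∨ (old w ≠ ⊤ ∧ d ≤ old w))})
      then d else ⊤

open scoped Classical in
/-- One update of the tree rooted at `s` at scale `i`, up to depth `2^i`. Each vertex keeps its
parent when that is still a best connection and otherwise gets some best connection. -/
noncomputable def update (i t : ℕ) (s : V) (old : PTree V) : PTree V where
  lev := R.sweep i t s old.lev (2 ^ i)
  par := fun v =>
    let best : Set V :=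
      {x | (R.G t).Adj v x ∧
        R.sweep i t s old.lev (2 ^ i) x + 1 = R.sweep i t s old.lev (2 ^ i) v}
    if old.par v ∈ best then old.par v else R.pick best

/-- The light tree `T(s)` at scale `i` in version `t`. -/
noncomputable def tree (i : ℕ) (s : V) : ℕ → PTree V
  | 0 => R.update i 0 s ⟨fun _ => ⊤, id⟩
  | t + 1 => R.update i (t + 1) s (tree i s t)

/-! ## Pivots and queries -/

/-- The vertices `p ∈ S i` that minimize `dist(v, p, T(p))` among those with `v ∈ T(p)`. -/
def pivots (t i : ℕ) (v : V) : Set V :=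
  {p | p ∈ R.S i ∧ v ∈ (R.tree i p t).verts ∧
    ∀ p' ∈ R.S i, v ∈ (R.tree i p' t).verts →
      (R.tree i p t).dist v p ≤ (R.tree i p' t).dist v p'}

/-- The pivot `p_i(v)`. -/
def pivot (t i : ℕ) (v : V) : V := R.pick (R.pivots t i v)

/-- The pivot `p_i(x)` exists and its tree contains `y`. -/
def Good (t : ℕ) (x y : V) (i : ℕ) : Prop :=
  1 ≤ i ∧ i ≤ numLevels (Fintype.card V) ∧ (R.pivots t i x).Nonempty ∧
    y ∈ (R.tree i (R.pivot t i x) t).verts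

open scoped Classical in
/-- The length of the path from `x` to `y` through the pivot of `x` at the least scale `i` with
`y ∈ T(p_i(x))` (`∞` if there is no such scale). -/
noncomputable def pivotPath (t : ℕ) (x y : V) : ℝ≥0∞ :=
  if h : ∃ i, R.Good t x y i then
    let i := Nat.find h
    let p := R.pivot t i x
    (R.tree i p t).dist x p + (R.tree i p t).dist y p
  else ∞

/-- The value returned by the query `(x, y)` after `t` deletions. -/
noncomputable def query (t : ℕ) (x y : V) : ℝ≥0∞ :=
  min (R.pivotPath t x y) (min (R.minHeap1 t x y) (R.fac * R.minHeapApx t x y))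

end Run

end DecOracle

/-! Soundness: light trees are subgraphs of the current graph, the exact heap holds lengths of
actual routes, and each lazily refreshed copy is within a factor `1+ε` below the current estimate,
so no term of the query undershoots.

For the upper bound let `d = dist(x,y)`. `exists_scale` gives a scale `i` with `2^i ≤ 3d` whose
trees are deep enough for `y`; put `r = ε 2^i`. If `dist_Q(x,y) ≤ (1+ε)(2r+d)+2`, the approximate
heap answers, losing two more factors (`query_le_distQ`). Otherwise no shortest path from a root `p`
within `r` of `x` to `x` or `y` meets a vertex that is not light: each of the three tests certifies
a route through `Q` that is too short (`distQ_le_of_notLight`, `lev_eq_or_distQ_le`), and extending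
it to `x` and `y` would contradict the case. So `x` and `y` have exact depth in these trees
(`lev_eq_of_lt_distQ`), and the pivot path has length at most `2r+d ≤ (1+6ε)d`.

No invariant of the trees is carried through time: an update from any previous tree places a vertex
at its exact distance unless some vertex on a shortest path fails the test. Only the lazy heaps need
induction over deletions.

For the probability, neighbourhoods and balls only shrink, so each such sequence has at most `n`
distinct nonempty members, and the union bound does not depend on the number of deletions
(`sampleSet_miss_antitone_le`). -/

namespace DecOracle

/-! ## Hop distances -/

section Distances

variable {V : Type*}

theorem gdist_comm (G : SimpleGraph V) (x y : V) : gdist G x y = gdist G y x := by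
  rw [gdist, gdist, SimpleGraph.edist_comm]

theorem gdist_triangle (G : SimpleGraph V) (x y z : V) :
    gdist G x z ≤ gdist G x y + gdist G y z := by
  unfold gdist
  exact_mod_cast G.edist_triangle

theorem gdist_anti {G G' : SimpleGraph V} (h : G ≤ G') (x y : V) :
    gdist G' x y ≤ gdist G x y := by
  unfold gdist
  exact_mod_cast SimpleGraph.edist_anti h

theorem graphAt_antitone (G₀ : SimpleGraph V) (del : ℕ → Sym2 V) : Antitone (graphAt G₀ del) := by
  intro t t' h
  refine SimpleGraph.deleteEdges_anti ?_
  rintro e ⟨k, hk, rfl⟩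
  exact ⟨k, hk.trans_le h, rfl⟩

theorem exists_adj_edist_eq {G : SimpleGraph V} {s v : V} {m : ℕ}
    (h : G.edist s v = ((m + 1 : ℕ) : ℕ∞)) : ∃ w, G.Adj v w ∧ G.edist s w = m := by
  -- Reversing the walk makes its first edge the one at `v`.
  rw [SimpleGraph.edist_comm] at h
  obtain ⟨p, hp⟩ := SimpleGraph.exists_walk_of_edist_eq_coe h
  cases p with
  | nil => simp at hp
  | @cons _ w _ hvw q =>
    refine ⟨w, hvw, le_antisymm ?_ ?_⟩
    · rw [SimpleGraph.edist_comm]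
      refine (SimpleGraph.edist_le q).trans ?_
      simp only [SimpleGraph.Walk.length_cons] at hp
      exact_mod_cast (by omega : q.length ≤ m)
    · have h1 : G.edist v s ≤ G.edist v w + G.edist w s := G.edist_triangle
      rw [h, SimpleGraph.edist_eq_one_iff_adj.2 hvw, SimpleGraph.edist_comm (u := w)] at h1
      push_cast at h1
      rw [add_comm (1 : ℕ∞)] at h1
      exact (ENat.add_le_add_iff_right (by simp)).1 h1

/-- A shortest walk can be taken without repeated vertices. Hence the depth cap `2^i` is harmless
once `n ≤ 2^i`. -/
theorem edist_lt_card [Fintype V] {G : SimpleGraph V} {x y : V} (h : G.edist x y ≠ ⊤) :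
    G.edist x y < (Fintype.card V : ℕ∞) := by
  classical
  obtain ⟨p⟩ := SimpleGraph.reachable_of_edist_ne_top h
  refine (SimpleGraph.edist_le p.toPath.1).trans_lt ?_
  exact_mod_cast p.toPath.2.length_lt

end Distances

/-! ## Attachment of a vertex to a partial tree -/

theorem exists_of_attach_eq {V : Type*} {G : SimpleGraph V} {lev : V → ℕ∞} {v : V} {k : ℕ}
    (h : attach G lev v = ((k + 1 : ℕ) : ℕ∞)) : ∃ x, G.Adj v x ∧ lev x = k := by
  -- The strict bound `k + 2` extracts a neighbour from the infimum; integrality then forces its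
  -- depth to be `k`.
  have h1 : attach G lev v < ((k + 2 : ℕ) : ℕ∞) := by
    rw [h]; exact_mod_cast Nat.lt_succ_self _
  obtain ⟨x, hx⟩ := iInf_lt_iff.1 h1
  obtain ⟨hvx, hx⟩ := iInf_lt_iff.1 hx
  have h2 : ((k + 1 : ℕ) : ℕ∞) ≤ lev x + 1 := by
    rw [← h]; exact iInf₂_le x hvx
  have hne : lev x ≠ ⊤ := by
    intro hx'
    rw [hx'] at hx
    simp at hx
  obtain ⟨m, hm⟩ := ENat.ne_top_iff_exists.1 hne
  rw [← hm] at hx h2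
  have h3 : m + 1 < k + 2 := by exact_mod_cast hx
  have h4 : k + 1 ≤ m + 1 := by exact_mod_cast h2
  exact ⟨x, hvx, hm.symm.trans (by exact_mod_cast (by omega : m = k))⟩

namespace Run

/-! ## Distances through `Q` -/

section DistQ

variable {V : Type*} {R : Run V}

theorem one_le_fac (hε : 0 < R.ε) : 1 ≤ R.fac := by
  rw [fac, ENNReal.one_le_ofReal]; linarith

theorem fac_ne_zero (hε : 0 < R.ε) : R.fac ≠ 0 :=
  (zero_lt_one.trans_le (one_le_fac hε)).ne'

theorem fac_ne_top : R.fac ≠ ∞ := ENNReal.ofReal_ne_top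

theorem gdist_mono_time (q x : V) : Monotone fun t => gdist (R.G t) q x :=
  fun _ _ h => gdist_anti (graphAt_antitone _ _ h) _ _

theorem distQ_le_of_forall_le {t : ℕ} {x y : V} {f : V → ℝ≥0∞} {c : ℝ≥0∞}
    (h : ∀ q ∈ R.Q, R.distVia t q x y ≤ f q + c) : R.distQ t x y ≤ (⨅ q ∈ R.Q, f q) + c := by
  -- Truncated subtraction moves `c` past the infimum, also when `Q` is empty.
  rw [← tsub_le_iff_right]
  refine le_iInf₂ fun q hq => ?_
  rw [tsub_le_iff_right]
  exact (iInf₂_le q hq).trans (h q hq)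

theorem distQ_le_add_left (t : ℕ) (x y z : V) :
    R.distQ t x z ≤ R.distQ t y z + gdist (R.G t) x y := by
  refine distQ_le_of_forall_le fun q _ => ?_
  calc R.distVia t q x z ≤ gdist (R.G t) x y + gdist (R.G t) y q + gdist (R.G t) q z := by
        unfold distVia; gcongr; exact gdist_triangle _ _ _ _
    _ = R.distVia t q y z + gdist (R.G t) x y := by unfold distVia; ring

theorem distQ_comm (t : ℕ) (x y : V) : R.distQ t x y = R.distQ t y x := by
  unfold distQ distVia
  refine iInf_congr fun q => iInf_congr fun _ => ?_
  rw [add_comm, gdist_comm _ q y, gdist_comm _ q x]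

end DistQ

variable {V : Type*} [Fintype V] (R : Run V)

/-! ## Levels of the light trees -/

section Sweep

variable (i t : ℕ) (s : V) (old : V → ℕ∞)

theorem sweep_succ_of_ne_top {k : ℕ} {v : V} (h : R.sweep i t s old k v ≠ ⊤) :
    R.sweep i t s old (k + 1) v = R.sweep i t s old k v := by
  simp [sweep, h]

theorem sweep_of_le {k m : ℕ} (hkm : k ≤ m) {v : V} (h : R.sweep i t s old k v ≠ ⊤) :
    R.sweep i t s old m v = R.sweep i t s old k v := by
  induction m, hkm using Nat.le_induction with
  | base => rfl
  | succ m _ ih => rw [R.sweep_succ_of_ne_top i t s old (by rwa [ih]), ih]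

theorem sweep_root (k : ℕ) : R.sweep i t s old k s = 0 := by
  have h : R.sweep i t s old 0 s = 0 := by simp [sweep]
  rw [R.sweep_of_le i t s old (Nat.zero_le k) (by simp [h]), h]

/-- Every placed non-root vertex has a neighbour exactly one level higher up; this supplies parents
and drives the inductions on depth. -/
theorem sweep_cases {k : ℕ} {v : V} (h : R.sweep i t s old k v ≠ ⊤) :
    v = s ∨ ∃ j < k, R.sweep i t s old k v = ((j + 1 : ℕ) : ℕ∞) ∧
      ∃ x, (R.G t).Adj v x ∧ R.sweep i t s old k x = j := by
  induction k with
  | zero =>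
    left
    by_contra hv
    simp [sweep, hv] at h
  | succ k ih =>
    by_cases hk : R.sweep i t s old k v = ⊤
    · right
      have h' := h
      simp only [sweep, hk, ne_eq, not_true_eq_false, if_false] at h'
      split_ifs at h' with hc
      · obtain ⟨x, hvx, hx⟩ := exists_of_attach_eq hc.1
        refine ⟨k, Nat.lt_succ_self k, ?_, x, hvx, ?_⟩
        · simp only [sweep, hk, ne_eq, not_true_eq_false, if_false]
          rw [if_pos hc]
        · rw [R.sweep_succ_of_ne_top i t s old (by simp [hx]), hx]
      · exact absurd rfl h'
    · rcases ih hk with hv | ⟨j, hj, hvj, x, hvx, hx⟩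
      · exact Or.inl hv
      · right
        refine ⟨j, by omega, ?_, x, hvx, ?_⟩
        · rw [R.sweep_succ_of_ne_top i t s old hk, hvj]
        · rw [R.sweep_succ_of_ne_top i t s old (by simp [hx]), hx]

theorem sweep_le {k : ℕ} {v : V} (h : R.sweep i t s old k v ≠ ⊤) :
    R.sweep i t s old k v ≤ k := by
  rcases R.sweep_cases i t s old h with rfl | ⟨j, hj, hv, -⟩
  · simp [sweep_root]
  · rw [hv]; exact_mod_cast hj

theorem edist_le_sweep (k : ℕ) (v : V) : (R.G t).edist s v ≤ R.sweep i t s old k v := by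
  by_cases h : R.sweep i t s old k v = ⊤
  · simp [h]
  obtain ⟨m, hm⟩ := ENat.ne_top_iff_exists.1 h
  induction m generalizing v with
  | zero =>
    rcases R.sweep_cases i t s old h with rfl | ⟨j, hj, hv, -⟩
    · simp
    · rw [← hm] at hv
      norm_cast at hv
  | succ m ih =>
    rcases R.sweep_cases i t s old h with rfl | ⟨j, hj, hv, x, hvx, hx⟩
    · simp
    · have hjm : j = m := by
        rw [← hm] at hv
        have : m + 1 = j + 1 := by exact_mod_cast hv
        omega
      subst hjm
      have h1 := ih x (by simp [hx]) hx.symm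
      calc (R.G t).edist s v ≤ (R.G t).edist s x + (R.G t).edist x v := SimpleGraph.edist_triangle
        _ ≤ j + 1 := by
          rw [SimpleGraph.edist_eq_one_iff_adj.2 hvx.symm]
          exact add_le_add (h1.trans hx.le) le_rfl
        _ = R.sweep i t s old k v := by rw [hv]; push_cast; rfl

/-- A vertex enters the tree at its distance from the root, unless a shortest path to it meets a
vertex that is not light. -/
theorem sweep_eq_or_notLight (m : ℕ) (v : V) (hv : (R.G t).edist s v = m) :
    R.sweep i t s old m v = m ∨ ∃ u, gdist (R.G t) s u + gdist (R.G t) u v ≤ m ∧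
      ∃ T, R.NotLight i t s u (gdist (R.G t) s u) T := by
  induction m generalizing v with
  | zero =>
    left
    have : s = v := by simpa using hv
    simp [sweep, this]
  | succ m ih =>
    obtain ⟨w, hvw, hw⟩ := exists_adj_edist_eq hv
    rcases ih w hw with hsw | ⟨u, hu, hT⟩
    · have htop : R.sweep i t s old m v = ⊤ := by
        by_contra hne
        have h1 := (R.edist_le_sweep i t s old m v).trans (R.sweep_le i t s old hne)
        rw [hv] at h1
        have : m + 1 ≤ m := by exact_mod_cast h1
        omega
      have hatt : attach (R.G t) (R.sweep i t s old m) v = ((m + 1 : ℕ) : ℕ∞) := by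
        refine le_antisymm ?_ (le_iInf₂ fun x hvx => ?_)
        · refine (iInf₂_le w hvw).trans ?_
          rw [hsw]; push_cast; rfl
        · rw [← hv]
          calc (R.G t).edist s v ≤ (R.G t).edist s x + (R.G t).edist x v :=
                SimpleGraph.edist_triangle
            _ ≤ R.sweep i t s old m x + 1 := by
              rw [SimpleGraph.edist_eq_one_iff_adj.2 hvx.symm]
              exact add_le_add (R.edist_le_sweep i t s old m x) le_rfl
      by_cases hL : R.sweep i t s old (m + 1) v = ((m + 1 : ℕ) : ℕ∞)
      · exact Or.inl hL
      · right
        simp only [sweep, htop, ne_eq, not_true_eq_false, if_false, hatt] at hL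
        split_ifs at hL with hc
        · exact absurd rfl hL
        -- The best connection has the right length, so rejection means that both ways of entering
        -- fail; the second one is the light test at the true distance.
        · push Not at hc
          have hd : gdist (R.G t) s v = (((m + 1 : ℕ) : ℕ∞) : ℝ≥0∞) := by rw [gdist, hv]
          refine ⟨v, ?_, _, hd ▸ (hc hatt).2⟩
          simp [gdist, hv]
    · right
      refine ⟨u, ?_, hT⟩
      calc gdist (R.G t) s u + gdist (R.G t) u v
          ≤ gdist (R.G t) s u + (gdist (R.G t) u w + gdist (R.G t) w v) := by
            gcongr; exact gdist_triangle _ _ _ _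
        _ ≤ m + 1 := by
          rw [← add_assoc]
          refine add_le_add hu ?_
          simp [gdist, SimpleGraph.edist_eq_one_iff_adj.2 hvw.symm]
        _ = ((m + 1 : ℕ) : ℝ≥0∞) := by push_cast; rfl

end Sweep

/-! ## The heaps -/

section Heaps

variable {R}

variable (R) in
/-- Every `H t` is an emulator of the current graph, with the error that the algorithm uses. -/
def HasEmulators : Prop :=
  ∀ t, IsEmulator (R.G t) (R.H t) (1 + R.ε / 2) (zeta (Fintype.card V) R.ε)

theorem gdist_le_distBR (hH : R.HasEmulators) (t : ℕ) (q x : V) :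
    gdist (R.G t) q x ≤ R.distBR t q x := by
  unfold distBR
  split_ifs
  · exact le_rfl
  · exact (hH t q x).1

/-- The emulator is only consulted beyond `β`, where its additive error `ζ = (ε/2)β` is at most
`ε/2` times the distance. -/
theorem distBR_le (hε : 0 < R.ε) (hH : R.HasEmulators) (t : ℕ) (q x : V) :
    R.distBR t q x ≤ R.fac * gdist (R.G t) q x := by
  unfold distBR
  split_ifs with h
  · exact le_mul_of_one_le_left' (one_le_fac hε)
  · refine (hH t q x).2.trans ?_
    have hz : zeta (Fintype.card V) R.ε = R.ε / 2 * R.bet := by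
      unfold bet beta; field_simp
    have hf : R.fac = ENNReal.ofReal (1 + R.ε / 2) + ENNReal.ofReal (R.ε / 2) := by
      rw [← ENNReal.ofReal_add (by positivity) (by positivity), fac]; congr 1; ring
    rw [hz, hf, ENNReal.ofReal_mul (by positivity), add_mul]
    gcongr
    exact (not_le.1 h).le

/-- A copy is left alone only if the estimate did not increase or is still below `1+ε` times the
copy. -/
theorem distBR_le_dLast (hε : 0 < R.ε) (t : ℕ) (x q : V) :
    R.distBR t q x ≤ R.fac * R.dLast t x q := by
  induction t with
  | zero => exact le_mul_of_one_le_left' (one_le_fac hε)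
  | succ t ih =>
    unfold dLast
    split_ifs with h
    · exact le_mul_of_one_le_left' (one_le_fac hε)
    · rcases not_and_or.1 h with h | h
      · exact (not_lt.1 h).trans ih
      · exact (not_le.1 h).le

/-- The copy is a past estimate, and true distances never decrease. The comparison goes through true
distances because the estimates themselves need not be monotone in time. -/
theorem dLast_le (hε : 0 < R.ε) (hH : R.HasEmulators) (t : ℕ) (x q : V) :
    R.dLast t x q ≤ R.fac * gdist (R.G t) q x := by
  induction t with
  | zero => exact distBR_le hε hH 0 q x
  | succ t ih =>
    unfold dLast
    split_ifs with h
    · exact distBR_le hε hH _ q x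
    · refine ih.trans ?_
      gcongr
      exact gdist_mono_time q x (Nat.le_succ t)

theorem distBRVia_le_heapStar (i t : ℕ) (x y q : V) :
    R.distBRVia t q x y ≤ R.heapStar i t x y q := by
  induction t with
  | zero =>
    unfold heapStar
    split_ifs
    · exact le_rfl
    · exact le_top
  | succ t ih =>
    unfold heapStar
    split_ifs with h1 h2
    · exact le_top
    · exact le_rfl
    · rw [not_or, not_lt, not_lt] at h2
      exact (add_le_add h2.1 h2.2).trans ih

theorem distQ_le_minHeapStar (hH : R.HasEmulators) (i t : ℕ) (x y : V) :
    R.distQ t x y ≤ R.minHeapStar i t x y := by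
  refine le_iInf₂ fun q hq => (iInf₂_le q hq).trans ?_
  refine le_trans ?_ (distBRVia_le_heapStar i t x y q)
  unfold distVia distBRVia
  rw [gdist_comm _ x q]
  exact add_le_add (gdist_le_distBR hH _ _ _) (gdist_le_distBR hH _ _ _)

/-- In the first test the loss is the additive 2; in the other two it is the division by `1+ε`. In
the second, the walk from `v` to `w` is prepended to the route from `w`. -/
theorem distQ_le_of_notLight (hε : 0 < R.ε) (hH : R.HasEmulators) {i t : ℕ} {s v : V}
    {d : ℝ≥0∞} {T : Set V} (h : R.NotLight i t s v d T) :
    R.distQ t v s ≤ R.fac * d + 2 := by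
  rcases h with ⟨-, h⟩ | ⟨-, -, w, -, -, h⟩ | ⟨-, h⟩
  · refine h.trans ?_
    gcongr
    exact le_mul_of_one_le_left' (one_le_fac hε)
  · refine le_trans ?_ le_self_add
    calc R.distQ t v s ≤ R.distQ t w s + gdist (R.G t) v w := distQ_le_add_left _ _ _ _
      _ ≤ R.fac * (R.minHeapStar i t w s / R.fac) + R.fac * gdist (R.G t) v w := by
        rw [ENNReal.mul_div_cancel (fac_ne_zero hε) fac_ne_top]
        exact add_le_add (distQ_le_minHeapStar hH i t w s)
          (le_mul_of_one_le_left' (one_le_fac hε))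
      _ = R.fac * (gdist (R.G t) v w + R.minHeapStar i t w s / R.fac) := by ring
      _ ≤ R.fac * d := by gcongr
  · refine le_trans ?_ le_self_add
    refine (distQ_le_minHeapStar hH i t v s).trans ?_
    rwa [ENNReal.div_le_iff' (fac_ne_zero hε) fac_ne_top] at h

theorem gdist_le_fac_mul_minHeapApx (hε : 0 < R.ε) (hH : R.HasEmulators) (t : ℕ) (x y : V) :
    gdist (R.G t) x y ≤ R.fac * R.minHeapApx t x y := by
  rw [← ENNReal.div_le_iff' (fac_ne_zero hε) fac_ne_top]
  refine le_iInf₂ fun q _ => ?_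
  rw [ENNReal.div_le_iff' (fac_ne_zero hε) fac_ne_top, heapApx, mul_add]
  calc gdist (R.G t) x y ≤ gdist (R.G t) q x + gdist (R.G t) q y := by
        rw [gdist_comm _ q x]; exact gdist_triangle _ _ _ _
    _ ≤ _ := add_le_add
        ((gdist_le_distBR hH _ _ _).trans (distBR_le_dLast hε _ _ _))
        ((gdist_le_distBR hH _ _ _).trans (distBR_le_dLast hε _ _ _))

theorem minHeapApx_le (hε : 0 < R.ε) (hH : R.HasEmulators) (t : ℕ) (x y : V) :
    R.minHeapApx t x y ≤ R.fac * R.distQ t x y := by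
  rw [← ENNReal.div_le_iff' (fac_ne_zero hε) fac_ne_top]
  refine le_iInf₂ fun q hq => ?_
  rw [ENNReal.div_le_iff' (fac_ne_zero hε) fac_ne_top]
  refine (iInf₂_le q hq).trans ?_
  unfold heapApx distVia
  rw [mul_add, gdist_comm _ x q]
  exact add_le_add (dLast_le hε hH _ _ _) (dLast_le hε hH _ _ _)

end Heaps

/-! ## The light trees -/

section Trees

variable {R}

/-- Forgets the history: all facts about light trees hold for an update of an arbitrary earlier
tree. -/
theorem exists_tree_eq_update (R : Run V) (i : ℕ) (s : V) (t : ℕ) :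
    ∃ old : PTree V, R.tree i s t = R.update i t s old := by
  cases t with
  | zero => exact ⟨_, rfl⟩
  | succ t => exact ⟨_, rfl⟩

theorem edist_le_lev (i : ℕ) (s : V) (t : ℕ) (v : V) :
    (R.G t).edist s v ≤ (R.tree i s t).lev v := by
  obtain ⟨old, h⟩ := R.exists_tree_eq_update i s t
  rw [h]
  exact R.edist_le_sweep i t s old.lev (2 ^ i) v

theorem lev_le {i : ℕ} {s : V} {t : ℕ} {v : V} (hv : v ∈ (R.tree i s t).verts) :
    (R.tree i s t).lev v ≤ ((2 ^ i : ℕ) : ℕ∞) := by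
  obtain ⟨old, h⟩ := R.exists_tree_eq_update i s t
  rw [PTree.verts, Set.mem_ofPred_eq, h] at hv
  rw [h]
  exact R.sweep_le i t s old.lev hv

theorem lev_eq_or_distQ_le (hε : 0 < R.ε) (hH : R.HasEmulators) {i t : ℕ} {s v : V}
    (hv : gdist (R.G t) s v ≤ 2 ^ i) :
    (R.tree i s t).lev v = (R.G t).edist s v ∨
      R.distQ t v s ≤ R.fac * gdist (R.G t) s v + 2 := by
  have hle : (R.G t).edist s v ≤ ((2 ^ i : ℕ) : ℕ∞) := by
    rw [← ENat.toENNReal_le]; simpa [gdist] using hv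
  obtain ⟨m, hm⟩ := ENat.ne_top_iff_exists.1
    (ne_top_of_le_ne_top (ENat.natCast_ne_top _) hle)
  obtain ⟨old, h⟩ := R.exists_tree_eq_update i s t
  rw [← hm] at hle
  rcases R.sweep_eq_or_notLight i t s old.lev m v hm.symm with h1 | ⟨u, hu, T, hT⟩
  · left
    rw [h, ← hm, ← h1]
    exact R.sweep_of_le i t s old.lev (by exact_mod_cast hle) (by simp [h1])
  · right
    have hg : gdist (R.G t) s v = m := by simp [gdist, ← hm]
    -- The route through `Q` at `u` is prolonged along the rest of a shortest path to `v`.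
    calc R.distQ t v s ≤ R.distQ t u s + gdist (R.G t) v u := distQ_le_add_left _ _ _ _
      _ ≤ (R.fac * gdist (R.G t) s u + 2) + R.fac * gdist (R.G t) u v := by
        rw [gdist_comm _ v u]
        exact add_le_add (distQ_le_of_notLight hε hH hT)
          (le_mul_of_one_le_left' (one_le_fac hε))
      _ = R.fac * (gdist (R.G t) s u + gdist (R.G t) u v) + 2 := by ring
      _ ≤ R.fac * gdist (R.G t) s v + 2 := by rw [hg]; gcongr

variable (R) in
/-- The rule that breaks ties picks an element of every nonempty set. -/
def PicksMember : Prop := ∀ A : Set V, A.Nonempty → R.pick A ∈ A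

theorem adj_par (hp : R.PicksMember) {i : ℕ} {s : V} {t : ℕ} {v : V}
    (h1 : (R.tree i s t).lev v ≠ ⊤) (h0 : (R.tree i s t).lev v ≠ 0) :
    (R.G t).Adj v ((R.tree i s t).par v) ∧
      (R.tree i s t).lev ((R.tree i s t).par v) + 1 = (R.tree i s t).lev v := by
  obtain ⟨old, h⟩ := R.exists_tree_eq_update i s t
  rw [h] at h1 h0 ⊢
  let best : Set V := {x | (R.G t).Adj v x ∧
    R.sweep i t s old.lev (2 ^ i) x + 1 = R.sweep i t s old.lev (2 ^ i) v}
  have hbest : best.Nonempty := by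
    rcases R.sweep_cases i t s old.lev h1 with rfl | ⟨j, -, hj, x, hvx, hx⟩
    · exact absurd (R.sweep_root i t _ old.lev (2 ^ i)) h0
    · exact ⟨x, hvx, by rw [hx, hj]; push_cast; rfl⟩
  change (R.update i t s old).par v ∈ best
  simp only [update]
  split_ifs with hc
  · exact hc
  · exact hp _ hbest

theorem tree_graph_le (hp : R.PicksMember) (i : ℕ) (s : V) (t : ℕ) :
    (R.tree i s t).graph ≤ R.G t := by
  intro v x hvx
  rw [PTree.graph, SimpleGraph.fromRel_adj] at hvx
  rcases hvx with ⟨-, ⟨h1, h0, rfl⟩ | ⟨h1, h0, rfl⟩⟩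
  · exact (adj_par hp h1 h0).1
  · exact (adj_par hp h1 h0).1.symm

theorem gdist_le_tree_dist (hp : R.PicksMember) (i : ℕ) (s : V) (t : ℕ) (u v : V) :
    gdist (R.G t) u v ≤ (R.tree i s t).dist u v :=
  gdist_anti (tree_graph_le hp i s t) u v

/-- Each parent is one level closer, and only the root has depth 0 since depths dominate distances.
-/
theorem tree_dist_le_lev (hp : R.PicksMember) (i : ℕ) (s : V) (t : ℕ) (v : V) :
    (R.tree i s t).dist v s ≤ (R.tree i s t).lev v := by
  unfold PTree.dist gdist
  rw [ENat.toENNReal_le]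
  by_cases h1 : (R.tree i s t).lev v = ⊤
  · simp [h1]
  obtain ⟨m, hm⟩ := ENat.ne_top_iff_exists.1 h1
  induction m generalizing v with
  | zero =>
    have h := (edist_le_lev i s t v).trans hm.symm.le
    have : s = v := by simpa using h
    simp [this]
  | succ m ih =>
    have h0 : (R.tree i s t).lev v ≠ 0 := by
      rw [← hm]; simp
    obtain ⟨hadj, hlev⟩ := adj_par hp h1 h0
    have hm' : (m : ℕ∞) = (R.tree i s t).lev ((R.tree i s t).par v) := by
      rw [← hm] at hlev
      push_cast at hlev
      exact ((ENat.add_left_injective_of_ne_top (by simp)) hlev).symm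
    have hT : (R.tree i s t).graph.Adj v ((R.tree i s t).par v) := by
      rw [PTree.graph, SimpleGraph.fromRel_adj]
      exact ⟨hadj.ne, Or.inl ⟨h1, h0, rfl⟩⟩
    calc (R.tree i s t).graph.edist v s
        ≤ (R.tree i s t).graph.edist v ((R.tree i s t).par v)
          + (R.tree i s t).graph.edist ((R.tree i s t).par v) s := SimpleGraph.edist_triangle
      _ ≤ 1 + (R.tree i s t).lev ((R.tree i s t).par v) := by
        rw [SimpleGraph.edist_eq_one_iff_adj.2 hT]
        exact add_le_add le_rfl (ih _ (by simp [← hm']) hm')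
      _ = (R.tree i s t).lev v := by rw [add_comm, hlev]

end Trees

/-! ## Queries -/

section Queries

variable {R}

theorem gdist_le_query (hε : 0 < R.ε) (hH : R.HasEmulators) (hp : R.PicksMember)
    (t : ℕ) (x y : V) : gdist (R.G t) x y ≤ R.query t x y := by
  refine le_min ?_ (le_min ?_ (gdist_le_fac_mul_minHeapApx hε hH t x y))
  · classical
    unfold pivotPath
    split_ifs with h
    · refine (gdist_triangle _ x (R.pivot t (Nat.find h) x) y).trans ?_
      rw [gdist_comm _ _ y]
      exact add_le_add (gdist_le_tree_dist hp _ _ _ _ _) (gdist_le_tree_dist hp _ _ _ _ _)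
    · exact le_top
  · exact le_iInf₂ fun q _ => le_iInf fun _ => gdist_triangle _ _ _ _

theorem query_le_distQ (hε : 0 < R.ε) (hH : R.HasEmulators) (t : ℕ) (x y : V) :
    R.query t x y ≤ R.fac ^ 2 * R.distQ t x y := by
  refine (min_le_right _ _).trans ((min_le_right _ _).trans ?_)
  rw [pow_two, mul_assoc]
  gcongr
  exact minHeapApx_le hε hH t x y

theorem pivot_mem (hp : R.PicksMember) {t j : ℕ} {x p : V} (hS : p ∈ R.S j)
    (hx : x ∈ (R.tree j p t).verts) :
    (R.pivots t j x).Nonempty ∧ R.pivot t j x ∈ R.pivots t j x := by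
  have hne : (R.pivots t j x).Nonempty := by
    obtain ⟨p', ⟨h1, h2⟩, hmin⟩ := Set.exists_min_image
      {p | p ∈ R.S j ∧ x ∈ (R.tree j p t).verts} (fun p => (R.tree j p t).dist x p)
      (Set.toFinite _) ⟨p, hS, hx⟩
    exact ⟨p', h1, h2, fun p'' h3 h4 => hmin p'' ⟨h3, h4⟩⟩
  exact ⟨hne, hp _ hne⟩

/-- If there is no good path through `Q`, the distances from `x` and `y` to a root near `x` are
exact in the tree of that root. -/
theorem lev_eq_of_lt_distQ (hε : 0 < R.ε) (hH : R.HasEmulators) {t j : ℕ} {x y p v : V}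
    {r : ℝ≥0∞} (hQ : R.fac * (2 * r + gdist (R.G t) x y) + 2 < R.distQ t x y)
    (hr : gdist (R.G t) x p ≤ r) (hv : v = x ∨ v = y) (hj : gdist (R.G t) p v ≤ 2 ^ j) :
    (R.tree j p t).lev v = (R.G t).edist p v := by
  refine (lev_eq_or_distQ_le hε hH hj).resolve_right fun h => hQ.not_ge ?_
  have hpy : gdist (R.G t) p y ≤ r + gdist (R.G t) x y := by
    refine (gdist_triangle _ p x y).trans ?_
    rw [gdist_comm _ p x]
    gcongr
  have h1 := one_le_fac hε
  -- A short route through `Q` between `p` and one endpoint, joined to a shortest path from `p` to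
  -- the other endpoint, is a short route through `Q` between `x` and `y`.
  rcases hv with rfl | rfl
  · calc R.distQ t v y ≤ R.distQ t p v + gdist (R.G t) p y := by
          rw [distQ_comm t v y, gdist_comm _ p y]
          exact distQ_le_add_left t y p v
      _ ≤ (R.fac * r + 2) + R.fac * (r + gdist (R.G t) v y) := by
        rw [distQ_comm]
        refine add_le_add (h.trans ?_) (hpy.trans (le_mul_of_one_le_left' h1))
        rw [gdist_comm]
        gcongr
      _ = _ := by ring
  · calc R.distQ t x v ≤ R.distQ t p v + gdist (R.G t) x p := distQ_le_add_left _ _ _ _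
      _ ≤ (R.fac * (r + gdist (R.G t) x v) + 2) + R.fac * r := by
        rw [distQ_comm]
        refine add_le_add (h.trans ?_) (hr.trans (le_mul_of_one_le_left' h1))
        gcongr
      _ = _ := by ring

end Queries

end Run

/-! ## The choice of the scale -/

/-- Take the least `i ≥ 1` for which a root within `ε 2^i` of one endpoint has depth budget for the
other, or for which `2^i` exceeds every finite distance. The second option keeps `i ≤ ⌈log₂ n⌉`. -/
theorem exists_scale {ε : ℝ} (hε : 0 < ε) (hε3 : ε ≤ 1 / 3) {n d : ℕ} (hn : 2 ≤ n) (hd : 1 ≤ d) :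
    ∃ i, 1 ≤ i ∧ i ≤ numLevels n ∧ ε * 2 ^ i ≤ d ∧ (2 : ℝ) ^ i ≤ 3 * d ∧
      ((d : ℝ) + ε * 2 ^ i ≤ 2 ^ i ∨ n ≤ 2 ^ i) := by
  have hd' : (1 : ℝ) ≤ d := by exact_mod_cast hd
  have hex : ∃ i, 1 ≤ i ∧ ((d : ℝ) + ε * 2 ^ i ≤ 2 ^ i ∨ n ≤ 2 ^ i) :=
    ⟨n, by omega, Or.inr (Nat.lt_two_pow_self).le⟩
  classical
  obtain ⟨h1, h2⟩ := Nat.find_spec hex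
  have hmin := fun m => Nat.find_min (m := m) hex
  set i := Nat.find hex
  have hiL : i ≤ numLevels n := by
    refine Nat.find_min' hex ⟨?_, Or.inr (Nat.le_pow_clog (by norm_num) n)⟩
    exact Nat.clog_pos (by norm_num) hn
  have h3 : (2 : ℝ) ^ i ≤ 3 * d := by
    -- Minimality gives `(1-ε) 2^(i-1) < d`, hence `2^i < 2d/(1-ε) ≤ 3d` as `ε ≤ 1/3`.
    rcases Nat.lt_or_ge 1 i with hi | hi
    · have h4 := hmin (i - 1) (by omega)
      push Not at h4
      have h5 := (h4 (by omega)).1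
      obtain ⟨k, hk⟩ : ∃ k, i = k + 1 := ⟨i - 1, by omega⟩
      rw [hk] at h5 ⊢
      simp only [Nat.add_sub_cancel] at h5
      have : (0 : ℝ) < 2 ^ k := by positivity
      rw [pow_succ]
      nlinarith
    · have : i = 1 := by omega
      rw [this]; linarith
  refine ⟨i, h1, hiL, ?_, h3, h2⟩
  have : (0 : ℝ) < 2 ^ i := by positivity
  nlinarith

namespace Run

variable {V : Type*} [Fintype V] {R : Run V}

theorem query_le (hε : 0 < R.ε) (hε3 : R.ε ≤ 1 / 3) (hH : R.HasEmulators)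
    (hp : R.PicksMember) {t : ℕ} (hhit : HitsAll R.ε (R.G t) R.Q R.S) {x y : V} (hxy : x ≠ y) :
    R.query t x y ≤ R.fac ^ 9 * (gdist (R.G t) x y + 2) := by
  have hf1 := one_le_fac hε
  by_cases htop : gdist (R.G t) x y = ∞
  · rw [htop, top_add, ENNReal.mul_top (pow_ne_zero _ (fac_ne_zero hε))]
    exact le_top
  have htop' : (R.G t).edist x y ≠ ⊤ := by
    simpa [gdist] using htop
  obtain ⟨d, hd⟩ := ENat.ne_top_iff_exists.1 htop'
  have hgd : gdist (R.G t) x y = d := by simp [gdist, ← hd]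
  have hd1 : 1 ≤ d := by
    have h := SimpleGraph.edist_pos_of_ne (G := R.G t) hxy
    rw [← hd] at h
    exact_mod_cast h
  have hn : 2 ≤ Fintype.card V := Fintype.one_lt_card_iff.2 ⟨x, y, hxy⟩
  obtain ⟨i, hi1, hiL, hid, hi3, hi2⟩ := exists_scale hε hε3 hn hd1
  set r : ℝ≥0∞ := ENNReal.ofReal (R.ε * 2 ^ i) with hr
  -- Here `2r = 2ε 2^i ≤ 6εd`, and Bernoulli's inequality turns `1+6ε` into a sixth power.
  have hsix : 2 * r + gdist (R.G t) x y ≤ R.fac ^ 6 * gdist (R.G t) x y := by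
    have hb : (1 + 6 * R.ε) ≤ (1 + R.ε) ^ 6 := by
      simpa using one_add_mul_le_pow (by linarith : (-2 : ℝ) ≤ R.ε) 6
    have hdr : (0 : ℝ) ≤ d := by positivity
    rw [hgd, fac, ← ENNReal.ofReal_pow (by positivity), ← ENNReal.ofReal_natCast d,
      ← ENNReal.ofReal_mul (by positivity), hr, ← ENNReal.ofReal_ofNat 2,
      ← ENNReal.ofReal_mul (by positivity), ← ENNReal.ofReal_add (by positivity) hdr]
    refine ENNReal.ofReal_le_ofReal ?_
    nlinarith
  by_cases hQ : R.distQ t x y ≤ R.fac * (2 * r + gdist (R.G t) x y) + 2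
  · calc R.query t x y ≤ R.fac ^ 2 * R.distQ t x y := query_le_distQ hε hH t x y
      _ ≤ R.fac ^ 2 * (R.fac * (R.fac ^ 6 * gdist (R.G t) x y) + R.fac ^ 7 * 2) := by
        gcongr
        refine hQ.trans ?_
        gcongr
        exact le_mul_of_one_le_left' (one_le_pow₀ hf1)
      _ = R.fac ^ 9 * (gdist (R.G t) x y + 2) := by ring
  · rw [not_le] at hQ
    have hscale : ∀ j, 1 ≤ j → j ≤ i → (R.pivots t j x).Nonempty ∧
        (R.tree j (R.pivot t j x) t).dist x (R.pivot t j x) ≤ ENNReal.ofReal (R.ε * 2 ^ j) := by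
      intro j hj1 hji
      have hpow : (2 : ℝ) ^ j ≤ 2 ^ i := pow_le_pow_right₀ (by norm_num) hji
      -- `y` itself is the far vertex required by the good event, since `ε 2^j ≤ ε 2^i ≤ d`.
      obtain ⟨p, hpS, hpx⟩ := hhit.2.1 x j hj1 (hji.trans hiL) ⟨y, by
        rw [hgd, ← ENNReal.ofReal_natCast d]
        refine ENNReal.ofReal_le_ofReal ?_
        nlinarith, htop⟩
      have hpx : gdist (R.G t) x p ≤ ENNReal.ofReal (R.ε * 2 ^ j) := hpx
      have hlev := lev_eq_of_lt_distQ (j := j) (p := p) hε hH hQ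
        (hpx.trans (ENNReal.ofReal_le_ofReal (by nlinarith))) (Or.inl rfl) (by
          rw [gdist_comm]
          refine hpx.trans ?_
          rw [← ENNReal.ofReal_ofNat 2, ← ENNReal.ofReal_pow (by positivity)]
          refine ENNReal.ofReal_le_ofReal ?_
          have : (0 : ℝ) < 2 ^ j := by positivity
          nlinarith)
      have hgl : ((R.tree j p t).lev x : ℝ≥0∞) ≤ ENNReal.ofReal (R.ε * 2 ^ j) := by
        rw [hlev]
        rw [gdist_comm] at hpx
        exact hpx
      have hxv : x ∈ (R.tree j p t).verts := by
        intro h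
        rw [h] at hgl
        simp at hgl
      obtain ⟨hne, -, -, hmin⟩ := pivot_mem hp hpS hxv
      exact ⟨hne, (hmin p hpS hxv).trans ((tree_dist_le_lev hp j p t x).trans hgl)⟩
    have hnear : ∀ j, 1 ≤ j → j ≤ i → gdist (R.G t) x (R.pivot t j x) ≤ r := by
      intro j hj1 hji
      refine (gdist_le_tree_dist hp j _ t _ _).trans ((hscale j hj1 hji).2.trans ?_)
      refine ENNReal.ofReal_le_ofReal ?_
      have hpow : (2 : ℝ) ^ j ≤ 2 ^ i := pow_le_pow_right₀ (by norm_num) hji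
      nlinarith
    have hpy : ∀ j, 1 ≤ j → j ≤ i →
        gdist (R.G t) (R.pivot t j x) y ≤ r + gdist (R.G t) x y := by
      intro j hj1 hji
      refine (gdist_triangle _ _ x y).trans ?_
      rw [gdist_comm _ _ x]
      gcongr
      exact hnear j hj1 hji
    have hgood : R.Good t x y i := by
      refine ⟨hi1, hiL, (hscale i hi1 le_rfl).1, ?_⟩
      have hfin : gdist (R.G t) (R.pivot t i x) y ≠ ∞ := by
        refine ne_top_of_le_ne_top ?_ (hpy i hi1 le_rfl)
        rw [hgd]
        exact ENNReal.add_ne_top.2 ⟨ENNReal.ofReal_ne_top, ENNReal.natCast_ne_top d⟩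
      have hfin' : (R.G t).edist (R.pivot t i x) y ≠ ⊤ := by simpa [gdist] using hfin
      have hlev := lev_eq_of_lt_distQ (j := i) (p := R.pivot t i x) hε hH hQ
        (hnear i hi1 le_rfl) (Or.inr rfl) (by
          rcases hi2 with hi2 | hi2
          · refine (hpy i hi1 le_rfl).trans ?_
            rw [hgd, ← ENNReal.ofReal_natCast d, hr,
              ← ENNReal.ofReal_add (by positivity) (by positivity), ← ENNReal.ofReal_ofNat 2,
              ← ENNReal.ofReal_pow (by positivity)]
            exact ENNReal.ofReal_le_ofReal (by linarith)
          · have h1 : (R.G t).edist (R.pivot t i x) y ≤ ((2 ^ i : ℕ) : ℕ∞) :=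
              (edist_lt_card hfin').le.trans (by exact_mod_cast hi2)
            have h2 := ENat.toENNReal_le.2 h1
            simpa [gdist] using h2)
      change (R.tree i (R.pivot t i x) t).lev y ≠ ⊤
      rw [hlev]
      exact hfin'
    have hpath : R.pivotPath t x y ≤ 2 * r + gdist (R.G t) x y := by
      classical
      have hex : ∃ j, R.Good t x y j := ⟨i, hgood⟩
      unfold pivotPath
      rw [dif_pos hex]
      have hji : Nat.find hex ≤ i := Nat.find_min' hex hgood
      obtain ⟨hj1, -, -, hyv⟩ := Nat.find_spec hex
      generalize Nat.find hex = j at hji hj1 hyv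
      -- The query may stop at a scale `j < i`. There membership of `y` in the tree already bounds
      -- its distance from the pivot by `2^j`, so its depth is again exact.
      have hlev := lev_eq_of_lt_distQ (j := j) (p := R.pivot t j x) hε hH hQ
        (hnear j hj1 hji) (Or.inr rfl) (by
          have h1 := ENat.toENNReal_le.2 ((edist_le_lev j _ t y).trans (lev_le hyv))
          simpa [gdist] using h1)
      have hy : (R.tree j (R.pivot t j x) t).dist y (R.pivot t j x)
          ≤ r + gdist (R.G t) x y := by
        refine (tree_dist_le_lev hp j _ t y).trans ?_
        rw [hlev]
        exact hpy j hj1 hji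
      have hx : (R.tree j (R.pivot t j x) t).dist x (R.pivot t j x) ≤ r := by
        refine (hscale j hj1 hji).2.trans (ENNReal.ofReal_le_ofReal ?_)
        have hpow : (2 : ℝ) ^ j ≤ 2 ^ i := pow_le_pow_right₀ (by norm_num) hji
        nlinarith
      refine (add_le_add hx hy).trans (le_of_eq ?_)
      ring
    calc R.query t x y ≤ R.pivotPath t x y := min_le_left _ _
      _ ≤ R.fac ^ 6 * gdist (R.G t) x y := hpath.trans hsix
      _ ≤ R.fac ^ 9 * (gdist (R.G t) x y + 2) := by
        gcongr
        · norm_num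
        · exact le_self_add

end Run

/-! ## The probability of the good event -/

section Sampling

open MeasureTheory

instance (V : Type*) (p : ℝ) : IsProbabilityMeasure (sampleSet V p) := by
  unfold sampleSet; infer_instance

instance (V : Type*) [Fintype V] (ε c : ℝ) : IsProbabilityMeasure (sampling V ε c) := by
  unfold sampling; infer_instance

/-- The probability that a random set misses `A` is at most `exp (-p |A|)`. -/
theorem sampleSet_miss_le {V : Type*} [Fintype V] {p : ℝ} (hp : 0 ≤ p) (A : Set V) :
    sampleSet V p {S | S ∩ A = ∅} ≤ ENNReal.ofReal (Real.exp (-p * A.ncard)) := by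
  classical
  set u := Set.projIcc (0 : ℝ) 1 zero_le_one p with hu
  -- In the product space of membership bits, missing `A` is the cylinder on which all bits of `A`
  -- are false.
  have hpre : (fun P : V → Prop => {i | P i}) ⁻¹' {S | S ∩ A = ∅} =
      Set.pi (A.toFinset : Set V) fun _ => {False} := by
    ext P
    simp only [Set.mem_preimage, Set.mem_ofPred_eq, Set.mem_pi, Set.mem_singleton_iff,
      Set.coe_toFinset, eq_iff_iff, iff_false, Set.eq_empty_iff_forall_notMem, Set.mem_inter_iff,
      not_and']
  have hq : ((unitInterval.toNNReal (unitInterval.symm u) : ℝ≥0) : ℝ≥0∞)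
      ≤ ENNReal.ofReal (Real.exp (-p)) := by
    have h1 : ((unitInterval.toNNReal (unitInterval.symm u) : ℝ≥0) : ℝ≥0∞)
        = ENNReal.ofReal (1 - u) := by
      rw [ENNReal.ofReal, ENNReal.coe_inj]
      ext
      rw [Real.coe_toNNReal _ (by linarith [u.2.2])]
      rfl
    rw [h1]
    refine ENNReal.ofReal_le_ofReal ?_
    rw [hu, Set.coe_projIcc]
    -- Rates above 1 are clipped, and then a vertex is never missed.
    rcases le_total p 1 with h | h
    · rw [min_eq_right h, max_eq_right hp]
      linarith [Real.add_one_le_exp (-p)]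
    · rw [min_eq_left h]
      simp [(Real.exp_pos (-p)).le]
  rw [sampleSet, ProbabilityTheory.setBernoulli_apply', hpre,
    Measure.infinitePi_pi _ (fun _ _ => MeasurableSet.of_discrete)]
  calc _ = ∏ _i ∈ A.toFinset, ((unitInterval.toNNReal (unitInterval.symm u) : ℝ≥0) : ℝ≥0∞) := by
        refine Finset.prod_congr rfl fun i _ => ?_
        rw [Measure.add_apply, Measure.smul_apply, Measure.smul_apply,
          Measure.dirac_apply' _ MeasurableSet.of_discrete,
          Measure.dirac_apply' _ MeasurableSet.of_discrete,
          Set.indicator_of_notMem (by simp), Set.indicator_of_mem (by simp), smul_zero, zero_add,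
          Pi.one_apply, ENNReal.smul_def, smul_eq_mul, mul_one]
    _ ≤ ∏ _i ∈ A.toFinset, ENNReal.ofReal (Real.exp (-p)) :=
        Finset.prod_le_prod' fun _ _ => hq
    _ = ENNReal.ofReal (Real.exp (-p * A.ncard)) := by
        rw [Finset.prod_const, ← ENNReal.ofReal_pow (Real.exp_pos _).le, ← Real.exp_nat_mul,
          Set.ncard_eq_toFinset_card', mul_comm]

/-- At rate `c ln n / r`, a random set misses a set of at least `r` vertices with probability at
most `n ^ (-c)`. -/
theorem sampleSet_miss_le_rpow {V : Type*} [Fintype V] [Nonempty V] {c r : ℝ} (hc : 0 < c)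
    (hr : 0 < r) {A : Set V} (hA : r ≤ A.ncard) :
    sampleSet V (c * Real.log (Fintype.card V) / r) {S | S ∩ A = ∅} ≤
      ENNReal.ofReal ((Fintype.card V : ℝ) ^ (-c)) := by
  have hn : (1 : ℝ) ≤ Fintype.card V := by exact_mod_cast Fintype.card_pos
  have hlog := Real.log_nonneg hn
  refine (sampleSet_miss_le (by positivity) A).trans (ENNReal.ofReal_le_ofReal ?_)
  rw [Real.rpow_def_of_pos (by linarith)]
  refine Real.exp_le_exp.2 ?_
  have h1 : c * Real.log (Fintype.card V) * 1 ≤ c * Real.log (Fintype.card V) * (A.ncard / r) := by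
    gcongr
    rwa [one_le_div hr]
  have h2 : -(c * Real.log (Fintype.card V) / r) * A.ncard
      = -(c * Real.log (Fintype.card V) * (A.ncard / r)) := by ring
  rw [h2]
  linarith

/-- A decreasing sequence of vertex sets has at most `n` different nonempty members, so a union
bound over the members costs a factor `n`. -/
theorem sampleSet_miss_antitone_le {V : Type*} [Fintype V] [Nonempty V] {c r : ℝ} (hc : 0 < c)
    (hr : 0 < r) {A : ℕ → Set V} (hA : Antitone A) :
    sampleSet V (c * Real.log (Fintype.card V) / r) {S | ∃ t, r ≤ (A t).ncard ∧ S ∩ A t = ∅} ≤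
      Fintype.card V * ENNReal.ofReal ((Fintype.card V : ℝ) ^ (-c)) := by
  set μ := sampleSet V (c * Real.log (Fintype.card V) / r)
  have hsub : {S | ∃ t, r ≤ (A t).ncard ∧ S ∩ A t = ∅} ⊆
      ⋃ k ∈ Finset.Icc 1 (Fintype.card V), {S | ∃ t, r ≤ (A t).ncard ∧ (A t).ncard = k ∧
        S ∩ A t = ∅} := by
    rintro S ⟨t, hrt, hS⟩
    refine Set.mem_iUnion₂.2 ⟨(A t).ncard, Finset.mem_Icc.2 ⟨?_, ?_⟩, t, hrt, rfl, hS⟩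
    · have : (0 : ℝ) < (A t).ncard := hr.trans_le hrt
      exact_mod_cast this
    · rw [← Nat.card_eq_fintype_card]
      exact Set.ncard_le_card _
  refine (measure_mono hsub).trans ((measure_biUnion_finset_le _ _).trans ?_)
  calc _ ≤ ∑ _k ∈ Finset.Icc 1 (Fintype.card V),
        ENNReal.ofReal ((Fintype.card V : ℝ) ^ (-c)) := by
        refine Finset.sum_le_sum fun k _ => ?_
        by_cases hk : ∃ t, r ≤ (A t).ncard ∧ (A t).ncard = k
        · obtain ⟨t, hrt, htk⟩ := hk
          refine (measure_mono ?_).trans (sampleSet_miss_le_rpow hc hr hrt)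
          rintro S ⟨t', -, ht', hS⟩
          -- Nested finite sets of equal size coincide, so each cardinality `k` contributes a single
          -- set.
          have : A t' = A t := by
            rcases le_total t t' with h | h
            · exact Set.eq_of_subset_of_ncard_le (hA h) (by omega)
            · exact (Set.eq_of_subset_of_ncard_le (hA h) (by omega)).symm
          change S ∩ A t = ∅
          rw [← this, hS]
        · rw [show {S | ∃ t, r ≤ (A t).ncard ∧ (A t).ncard = k ∧ S ∩ A t = ∅} = ∅ from
            Set.eq_empty_of_forall_notMem fun S ⟨t, h1, h2, _⟩ => hk ⟨t, h1, h2⟩, measure_empty]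
          exact zero_le
    _ = _ := by simp

theorem ball_antitone {V : Type*} {G G' : SimpleGraph V} (h : G ≤ G') (v : V) (r : ℝ) :
    ball G v r ⊆ ball G' v r :=
  fun _ hw => (gdist_anti h _ _).trans hw

theorem exists_edist_eq_of_le {V : Type*} {G : SimpleGraph V} {v : V} {m k : ℕ} (hk : k ≤ m) :
    ∀ {z : V}, G.edist v z = m → ∃ w, G.edist v w = k := by
  induction m, hk using Nat.le_induction with
  | base => exact fun h => ⟨_, h⟩
  | succ m _ ih =>
    intro z hz
    obtain ⟨w, -, hw⟩ := exists_adj_edist_eq hz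
    exact ih hw

/-- A ball that does not exhaust the component of its centre has at least as many vertices as its
radius. -/
theorem le_ncard_ball {V : Type*} [Finite V] {G : SimpleGraph V} {v z : V} {r : ℝ} (hr : 0 ≤ r)
    (hz : ENNReal.ofReal r ≤ gdist G v z) (hz' : gdist G v z ≠ ∞) :
    r ≤ (ball G v r).ncard := by
  obtain ⟨m, hm⟩ := ENat.ne_top_iff_exists.1 (by simpa [gdist] using hz' : G.edist v z ≠ ⊤)
  have hgm : gdist G v z = m := by simp [gdist, ← hm]
  have hrm : r ≤ m := by
    rw [hgm, ← ENNReal.ofReal_natCast] at hz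
    exact (ENNReal.ofReal_le_ofReal_iff (by positivity)).1 hz
  have hfl : ⌊r⌋₊ ≤ m := Nat.floor_le_of_le hrm
  -- One vertex at each distance `0, …, ⌊r⌋` gives `⌊r⌋ + 1 > r` vertices in the ball.
  have hw : ∀ k : Fin (⌊r⌋₊ + 1), ∃ w, G.edist v w = (k : ℕ) := fun k =>
    exists_edist_eq_of_le (by omega) hm.symm
  choose f hf using hw
  have hinj : Function.Injective f := by
    intro a b hab
    have h := hf a
    rw [hab, hf b] at h
    exact Fin.ext (by exact_mod_cast h.symm)
  have hsub : Set.range f ⊆ ball G v r := by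
    rintro _ ⟨k, rfl⟩
    change gdist G v (f k) ≤ ENNReal.ofReal r
    have : gdist G v (f k) = ((k : ℕ) : ℝ≥0∞) := by simp [gdist, hf]
    rw [this, ← ENNReal.ofReal_natCast]
    refine ENNReal.ofReal_le_ofReal (le_trans ?_ (Nat.floor_le hr))
    exact_mod_cast Nat.lt_succ_iff.1 k.2
  have hcard := Set.ncard_le_ncard hsub (Set.toFinite _)
  rw [← Nat.card_coe_set_eq, Nat.card_range_of_injective hinj, Nat.card_fin] at hcard
  exact (Nat.lt_floor_add_one r).le.trans (by exact_mod_cast hcard)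

theorem sampling_hitsAll_ge (V : Type*) [Fintype V] {ε c : ℝ} (hε : 0 < ε) (hc : 0 < c)
    (G₀ : SimpleGraph V) (del : ℕ → Sym2 V) :
    ENNReal.ofReal (1 - 3 / (Fintype.card V : ℝ) ^ (c - 3)) ≤
      sampling V ε c {ω | ∀ t, HitsAll ε (graphAt G₀ del t) ω.1 (levelSets ω.2)} := by
  rcases isEmpty_or_nonempty V with hV | hV
  · have hall : {ω : Set V × (Fin (numLevels (Fintype.card V)) → Set V) |
        ∀ t, HitsAll ε (graphAt G₀ del t) ω.1 (levelSets ω.2)} = Set.univ :=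
      Set.eq_univ_of_forall fun ω t => ⟨isEmptyElim, isEmptyElim, isEmptyElim⟩
    rw [hall, measure_univ, ← ENNReal.ofReal_one]
    refine ENNReal.ofReal_le_ofReal (sub_le_self _ ?_)
    positivity
  set n := Fintype.card V with hn
  have hn1 : (1 : ℝ) ≤ n := by exact_mod_cast Fintype.card_pos (α := V)
  have hsq : 0 < Real.sqrt n := Real.sqrt_pos.2 (by linarith)
  set G := graphAt G₀ del
  set L := numLevels n
  set μ := sampling V ε c
  set δ := ENNReal.ofReal ((n : ℝ) ^ (-c))
  -- The bad events are rectangles constraining a single sample, so their measure is computed in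
  -- that factor.
  let BQ : (ℕ → Set V) → Set (Set V × (Fin L → Set V)) := fun A =>
    {S | ∃ t, Real.sqrt n ≤ (A t).ncard ∧ S ∩ A t = ∅} ×ˢ Set.univ
  let BS : V → Fin L → Set (Set V × (Fin L → Set V)) := fun v k =>
    Set.univ ×ˢ (Set.univ.pi fun j => if j = k then
      {S | ∃ t, ε * 2 ^ ((k : ℕ) + 1) ≤ (ball (G t) v (ε * 2 ^ ((k : ℕ) + 1))).ncard ∧
        S ∩ ball (G t) v (ε * 2 ^ ((k : ℕ) + 1)) = ∅} else Set.univ)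
  have hBQ : ∀ A : ℕ → Set V, Antitone A → μ (BQ A) ≤ n * δ := by
    intro A hA
    rw [show μ (BQ A) = _ from Measure.prod_prod _ _, measure_univ, mul_one]
    exact sampleSet_miss_antitone_le hc hsq hA
  have hBS : ∀ v k, μ (BS v k) ≤ n * δ := by
    intro v k
    rw [show μ (BS v k) = _ from Measure.prod_prod _ _, measure_univ, one_mul, Measure.pi_pi,
      Finset.prod_eq_single k (fun j _ hj => by rw [if_neg hj, measure_univ]) (by simp),
      if_pos rfl]
    exact sampleSet_miss_antitone_le hc (by positivity)
      fun t t' h => ball_antitone (graphAt_antitone G₀ del h) v _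
  let N : V → ℕ → Set V := fun v t => (G t).neighborSet v
  let B : V → ℕ → Set V := fun v t => ball (G t) v (beta n ε)
  have hN : ∀ v, Antitone (N v) := fun v t t' h w hw => graphAt_antitone G₀ del h hw
  have hB : ∀ v, Antitone (B v) := fun v t t' h => ball_antitone (graphAt_antitone G₀ del h) v _
  have hbad : {ω | ∀ t, HitsAll ε (G t) ω.1 (levelSets ω.2)}ᶜ ⊆
      (⋃ v, BQ (N v)) ∪ (⋃ v, ⋃ k, BS v k) ∪ ⋃ v, BQ (B v) := by
    intro ω hω
    by_contra hgood
    simp only [Set.mem_union, Set.mem_iUnion, not_or, not_exists] at hgood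
    obtain ⟨⟨h1, h2⟩, h3⟩ := hgood
    refine hω fun t => ⟨fun v hv => ?_, fun v i hi1 hiL => ?_, fun v hv => ?_⟩
    · by_contra hne
      rw [Set.not_nonempty_iff_eq_empty, Set.inter_comm] at hne
      exact h1 v ⟨⟨t, hv.le, hne⟩, trivial⟩
    · rintro ⟨z, hz, hz'⟩
      by_contra hne
      rw [Set.not_nonempty_iff_eq_empty] at hne
      obtain ⟨k, rfl⟩ : ∃ k, i = k + 1 := ⟨i - 1, by omega⟩
      have hk : k < L := hiL
      refine h2 v ⟨k, hk⟩ ⟨trivial, fun j _ => ?_⟩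
      dsimp only
      split_ifs with hj
      · subst hj
        refine ⟨t, le_ncard_ball (by positivity) hz hz', ?_⟩
        refine Set.eq_empty_of_forall_notMem fun w hw => ?_
        have : w ∈ levelSets ω.2 (k + 1) ∩ ball (G t) v (ε * 2 ^ (k + 1)) :=
          ⟨⟨⟨k, hk⟩, rfl, hw.1⟩, hw.2⟩
        rw [hne] at this
        exact this
      · trivial
    · by_contra hne
      rw [Set.not_nonempty_iff_eq_empty] at hne
      exact h3 v ⟨⟨t, hv, hne⟩, trivial⟩
  -- There are `n` vertices, at most `n` scales and at most `n` distinct sets per sequence: this is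
  -- the exponent 3.
  have hLn : L ≤ n := Nat.clog_le_of_le_pow (Nat.lt_two_pow_self).le
  have hμbad : μ {ω | ∀ t, HitsAll ε (G t) ω.1 (levelSets ω.2)}ᶜ ≤ 3 * (n ^ 3 * δ) := by
    have hone : (1 : ℝ≥0∞) ≤ n := by exact_mod_cast Fintype.card_pos (α := V)
    have hQ : ∀ A : V → ℕ → Set V, (∀ v, Antitone (A v)) → μ (⋃ v, BQ (A v)) ≤ n ^ 3 * δ := by
      intro A hA
      calc μ (⋃ v, BQ (A v)) ≤ ∑ v, μ (BQ (A v)) := measure_iUnion_fintype_le _ _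
        _ ≤ ∑ _v : V, n * δ := Finset.sum_le_sum fun v _ => hBQ _ (hA v)
        _ = n ^ 2 * δ := by simp [← hn]; ring
        _ ≤ n ^ 3 * δ := by
          gcongr
          norm_num
    have hS : μ (⋃ v, ⋃ k, BS v k) ≤ n ^ 3 * δ := by
      calc μ (⋃ v, ⋃ k, BS v k) ≤ ∑ v, μ (⋃ k, BS v k) := measure_iUnion_fintype_le _ _
        _ ≤ ∑ v, ∑ k, μ (BS v k) := Finset.sum_le_sum fun v _ => measure_iUnion_fintype_le _ _
        _ ≤ ∑ _v : V, ∑ _k : Fin L, n * δ :=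
          Finset.sum_le_sum fun v _ => Finset.sum_le_sum fun k _ => hBS v k
        _ = n * (L * (n * δ)) := by simp [← hn]
        _ ≤ n * (n * (n * δ)) := by gcongr
        _ = n ^ 3 * δ := by ring
    refine (measure_mono hbad).trans ((measure_union_le _ _).trans ?_)
    refine (add_le_add ((measure_union_le _ _).trans (add_le_add (hQ N hN) hS)) (hQ B hB)).trans ?_
    exact le_of_eq (by ring)
  have hval : 3 * ((n : ℝ≥0∞) ^ 3 * δ) = ENNReal.ofReal (3 / (n : ℝ) ^ (c - 3)) := by
    have hpos : (0 : ℝ) < n := by linarith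
    have : 3 / (n : ℝ) ^ (c - 3) = 3 * ((n : ℝ) ^ 3 * (n : ℝ) ^ (-c)) := by
      rw [div_eq_mul_inv, ← Real.rpow_neg hpos.le, ← Real.rpow_natCast, ← Real.rpow_add hpos]
      congr 2
      push_cast
      ring
    rw [this, ENNReal.ofReal_mul (by norm_num), ENNReal.ofReal_mul (by positivity),
      ENNReal.ofReal_pow hpos.le, ENNReal.ofReal_natCast, ENNReal.ofReal_ofNat]
  rw [hval] at hμbad
  rw [ENNReal.ofReal_sub _ (by positivity), ENNReal.ofReal_one, tsub_le_iff_right,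
    ← measure_univ (μ := μ)]
  -- Subadditivity on the event and its complement suffices, with no measurability needed.
  refine le_trans ?_ (add_le_add le_rfl hμbad)
  rw [← Set.union_compl_self {ω | ∀ t, HitsAll ε (G t) ω.1 (levelSets ω.2)}]
  exact measure_union_le _ _

end Sampling

end DecOracle

theorem mainTheorem2 :
    ∃ C : ℕ, ∀ (V : Type*) [Fintype V] (ε c : ℝ), 0 < ε → ε ≤ 1 / 3 → 0 < c →
      ∀ (G₀ : SimpleGraph V) (del : ℕ → Sym2 V),
        (∀ (Q : Set V) (S : ℕ → Set V),
          (∀ t, DecOracle.HitsAll ε (DecOracle.graphAt G₀ del t) Q S) →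
          ∀ H : ℕ → DecOracle.WeightedGraph V,
            (∀ t, DecOracle.IsEmulator (DecOracle.graphAt G₀ del t) (H t) (1 + ε / 2)
              (DecOracle.zeta (Fintype.card V) ε)) →
            ∀ pick : Set V → V, (∀ A : Set V, A.Nonempty → pick A ∈ A) →
              ∀ (t : ℕ) (x y : V),
                DecOracle.gdist (DecOracle.graphAt G₀ del t) x y ≤
                    (DecOracle.Run.mk G₀ del ε Q S H pick).query t x y ∧
                (x ≠ y →
                  (DecOracle.Run.mk G₀ del ε Q S H pick).query t x y ≤
                    ENNReal.ofReal (1 + ε) ^ C *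
                      (DecOracle.gdist (DecOracle.graphAt G₀ del t) x y + 2))) ∧
        ENNReal.ofReal (1 - 3 / (Fintype.card V : ℝ) ^ (c - 3)) ≤
          DecOracle.sampling V ε c
            {ω | ∀ t, DecOracle.HitsAll ε (DecOracle.graphAt G₀ del t) ω.1
              (DecOracle.levelSets ω.2)} := by
  -- Two factors come from the approximate heap, one from the light test and six from the detour to
  -- the root.
  refine ⟨9, ?_⟩
  intro V _ ε c hε hε3 hc G₀ del
  refine ⟨fun Q S hhit H hH pick hpick t x y => ?_, DecOracle.sampling_hitsAll_ge V hε hc G₀ del⟩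
  exact ⟨DecOracle.Run.gdist_le_query (R := DecOracle.Run.mk G₀ del ε Q S H pick) hε hH hpick t x y,
    DecOracle.Run.query_le (R := DecOracle.Run.mk G₀ del ε Q S H pick) hε hε3 hH hpick (hhit t)⟩
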